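/- Let $p>3$ be a prime and let $m$ be a primitive root modulo $p$. Consider the Diffie–Hellman (DH) dynamical system $x_0=1$, $x_{k+1}=m x_k \bmod p\in\{0,\dots,p-1\}$, and put $\tilde q=(p-1)/2$. For $q\ge 0$ define the lifted state $z_k=h(x_k)=(x_k,x_{k+1},\dots,x_{k+q})^\top$, and for $N\ge 1$ the lifted data matrices with $q+1$ rows and $N$ columns $$Z=\begin{bmatrix} z_0& z_1&\cdots& z_{N-1}\end{bmatrix},\qquad Z_+=\begin{bmatrix} z_1& z_2&\cdots& z_{N}\end{bmatrix},$$ over $\mathbb K=\mathbb R$ or $\mathbb K=\mathbb C$. Assume $N\ge\tilde q+1$. 1. For every $q\ge\tilde q$, $\operatorname{rank}(Z)=\tilde q+1$. 2. Let $q=\tilde q$ and let $A$ be the $(\tilde q+1)\times(\tilde q+1)$ companion matrix $$A=\begin{bmatrix}0&1&\cdots&0\\ \vdots&\vdots&\ddots&\vdots\\ 0&0&\cdots&1\\ \alpha_0&\alpha_1&\cdots&\alpha_{\tilde q}\end{bmatrix},\qquad \alpha_0=1,\ \alpha_1=-1,\ \alpha_{\tilde q}=1,\ \alpha_j=0\ \text{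 for } 2\le j\le\tilde q-1.$$ Then $z_{k+1}=Az_k$ for all $k\ge 0$; the EDMD least-squares problem $\min_{B}\|Z_+-BZ\|_{\mathrm F}$ over all $B\in\mathbb K^{(\tilde q+1)\times(\tilde q+1)}$ ($\|\cdot\|_{\mathrm F}$ the Frobenius norm) has $A$ as its unique solution; moreover $ZZ^\top$ is invertible and $A=(Z_+Z^\top)(ZZ^\top)^{-1}$. -/

import Mathlib

namespace DHKoopman

/-- `m` is a primitive root modulo `p`: every integer coprime to `p` is congruent modulo `p`
to some power `m ^ k` with `k ≥ 1`. -/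
def IsPrimitiveRootMod (p m : ℕ) : Prop :=
  ∀ c : ℤ, IsCoprime c (p : ℤ) → ∃ k : ℕ, 1 ≤ k ∧ (m : ℤ) ^ k ≡ c [ZMOD (p : ℤ)]

/-- The state transition map `x ↦ m x mod p`. -/
def step (p m x : ℕ) : ℕ := m * x % p

/-- The trajectory `x₀ = 1`, `xₖ₊₁ = m xₖ mod p`. -/
def state (p m : ℕ) : ℕ → ℕ
  | 0 => 1
  | k + 1 => step p m (state p m k)

/-- The value-list lifting `h = (h₀, …, h_q)`: the `j`-th observable of a state `x` is the state
reached from `x` after `j` steps. -/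
def lift (𝕜 : Type*) [RCLike 𝕜] (p m q : ℕ) (x : ℕ) : Fin (q + 1) → 𝕜 :=
  fun j => (((step p m)^[(j : ℕ)] x : ℕ) : 𝕜)

theorem iterate_step_state (p m k j : ℕ) : (step p m)^[j] (state p m k) = state p m (k + j) := by
  induction j with
  | zero => rfl
  | succ j ih => rw [Function.iterate_succ_apply', ih]; rfl

/-- Along the trajectory, `h_j(xₖ) = xₖ₊ⱼ`. -/
theorem lift_state (𝕜 : Type*) [RCLike 𝕜] (p m q k : ℕ) (j : Fin (q + 1)) :
    lift 𝕜 p m q (state p m k) j = (state p m (k + j) : 𝕜) := by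
  simp [lift, iterate_step_state]

/-- The lifted data matrix `Z`, with columns `h(x₀), …, h(x_{N-1})`. -/
def dataZ (𝕜 : Type*) [RCLike 𝕜] (p m q N : ℕ) : Matrix (Fin (q + 1)) (Fin N) 𝕜 :=
  Matrix.of fun j k => lift 𝕜 p m q (state p m (k : ℕ)) j

/-- The shifted lifted data matrix `Z₊`, with columns `h(x₁), …, h(x_N)`. -/
def dataZplus (𝕜 : Type*) [RCLike 𝕜] (p m q N : ℕ) : Matrix (Fin (q + 1)) (Fin N) 𝕜 :=
  Matrix.of fun j k => lift 𝕜 p m q (state p m ((k : ℕ) + 1)) j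

/-- The companion matrix with ones on the superdiagonal and last row `α`. -/
def companion {𝕜 : Type*} [RCLike 𝕜] {q : ℕ} (α : Fin (q + 1) → 𝕜) :
    Matrix (Fin (q + 1)) (Fin (q + 1)) 𝕜 :=
  Matrix.of fun i j =>
    if i = Fin.last q then α j else if (j : ℕ) = (i : ℕ) + 1 then 1 else 0

/-- The last row `(1, -1, 0, …, 0, 1)` of length `q + 1` (used for `q ≥ 2`). -/
def coeff (𝕜 : Type*) [RCLike 𝕜] (q : ℕ) : Fin (q + 1) → 𝕜 :=
  fun j =>
    if (j : ℕ) = 0 then 1 else if (j : ℕ) = 1 then -1 else if (j : ℕ) = q then 1 else 0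

section Frobenius

attribute [local instance] Matrix.frobeniusNormedAddCommGroup

/-- `B` is a minimizer of `A ↦ ‖Z₊ - A Z‖` (Frobenius norm) over all square matrices `A`. -/
def IsEDMDEstimate {𝕜 : Type*} [RCLike 𝕜] {n N : ℕ} (Zplus Z : Matrix (Fin n) (Fin N) 𝕜)
    (B : Matrix (Fin n) (Fin n) 𝕜) : Prop :=
  IsMinOn (fun A : Matrix (Fin n) (Fin n) 𝕜 => ‖Zplus - A * Z‖) Set.univ B

end Frobenius

end DHKoopman

/-! Since `m ^ q' = -1` in `ZMod p`, states half a period apart sum to `p`. Eliminating `p` gives a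
recurrence of order `q' + 1` with characteristic polynomial `(z - 1)(z ^ q' + 1)`; this yields the
companion matrix and bounds the rank above. For the lower bound, let `c` annihilate all shifts of
the trajectory. Pairing with `w ^ k` over a period gives `P(w⁻¹) * S(w) = 0`, where `P` has
coefficients `c` and `S(w) = ∑ w ^ k x_k`. `S(1) > 0`, and if `w ^ q' = -1` then `S(w) = ∑ χ(j) j =
-p L(χ, 0)` for the odd character with `χ(m) = w`; this is nonzero by the functional equation and
`L(χ⁻¹, 1) ≠ 0`. So `P`, of degree at most `q'`, has `q' + 1` roots and vanishes
(`eq_zero_of_sum_mul_state_eq_zero_complex`). -/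

/-! ### Hurwitz zeta at `s = 0`, by analytic continuation of a series. -/

open Complex in
/-- First-order Taylor bound for `t ↦ t ^ (-s)` between two reals `≥ δ`. -/
theorem norm_cpow_neg_sub_linear_le {s : ℂ} {δ a b : ℝ} (hs : -2 ≤ s.re) (hδ : 0 < δ)
    (ha : δ ≤ a) (hb : δ ≤ b) :
    ‖(b : ℂ) ^ (-s) - (a : ℂ) ^ (-s) + s * (a : ℂ) ^ (-s - 1) * ((b : ℂ) - a)‖ ≤
      ‖s‖ * (‖s + 1‖ * δ ^ (-s.re - 2) * |b - a|) * |b - a| := by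
  rcases eq_or_ne s 0 with rfl | hs0
  · simp
  rcases eq_or_ne s (-1) with rfl | hs1
  · simp
  have hpos : ∀ t ∈ Set.uIcc a b, δ ≤ t := fun t ht ↦ (le_min ha hb).trans ht.1
  have hd : ∀ (r : ℂ), r ≠ 0 → ∀ t ∈ Set.uIcc a b,
      HasDerivAt (fun y : ℝ ↦ (y : ℂ) ^ r) (r * (t : ℂ) ^ (r - 1)) t := fun r hr t ht ↦
    hasDerivAt_ofReal_cpow_const (hδ.trans_le (hpos t ht)).ne' hr
  have hs1' : -s - 1 ≠ 0 := fun h ↦ hs1 (by linear_combination -h)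
  have h1 : ∀ t ∈ Set.uIcc a b,
      ‖(t : ℂ) ^ (-s - 1) - (a : ℂ) ^ (-s - 1)‖ ≤ ‖s + 1‖ * δ ^ (-s.re - 2) * |b - a| := by
    intro t ht
    refine (Convex.norm_image_sub_le_of_norm_hasDerivWithin_le
      (fun u hu ↦ (hd _ hs1' u hu).hasDerivWithinAt) (C := ‖s + 1‖ * δ ^ (-s.re - 2))
      (fun u hu ↦ ?_) (convex_uIcc a b) Set.left_mem_uIcc ht).trans ?_
    · have hu0 := hδ.trans_le (hpos u hu)
      rw [norm_mul, norm_cpow_eq_rpow_re_of_pos hu0, show -s - 1 = -(s + 1) by ring, norm_neg]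
      gcongr
      have : (-(s + 1) - 1).re = -s.re - 2 := by simp; ring
      rw [this]
      exact Real.rpow_le_rpow_of_nonpos hδ (hpos u hu) (by linarith)
    · rw [Real.norm_eq_abs]
      gcongr ?_ * ?_
      exact Set.abs_sub_left_of_mem_uIcc ht
  have h2 := Convex.norm_image_sub_le_of_norm_hasDerivWithin_le
    (f := fun t : ℝ ↦ (t : ℂ) ^ (-s) + s * (a : ℂ) ^ (-s - 1) * t)
    (f' := fun t : ℝ ↦ -s * (t : ℂ) ^ (-s - 1) + s * (a : ℂ) ^ (-s - 1) * 1)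
    (C := ‖s‖ * (‖s + 1‖ * δ ^ (-s.re - 2) * |b - a|))
    (fun u hu ↦ ((hd _ (neg_ne_zero.2 hs0) u hu).add
      (ofRealCLM.hasDerivAt.const_mul _)).hasDerivWithinAt)
    (fun u hu ↦ by
      rw [show -s * (u : ℂ) ^ (-s - 1) + s * (a : ℂ) ^ (-s - 1) * 1 =
        -s * ((u : ℂ) ^ (-s - 1) - (a : ℂ) ^ (-s - 1)) by ring, norm_mul, norm_neg]
      gcongr
      exact h1 u hu) (convex_uIcc a b) Set.left_mem_uIcc Set.right_mem_uIcc
  rw [Real.norm_eq_abs] at h2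
  convert! h2 using 2
  ring

/-- The error of linear interpolation of `t ↦ t ^ (-s)` at `n + x` from the nodes `n + 1` and
`n + 2`. -/
noncomputable def cpowInterpError (x : ℝ) (n : ℕ) (s : ℂ) : ℂ :=
  ((n + x : ℝ) : ℂ) ^ (-s) - ((n + 1 : ℝ) : ℂ) ^ (-s) -
    (1 - x) * (((n + 1 : ℝ) : ℂ) ^ (-s) - ((n + 2 : ℝ) : ℂ) ^ (-s))

/-- The first-order terms at `n + 1` cancel, leaving two Taylor remainders with `‖s‖ ≤ 3`, `‖s + 1‖
≤ 4`: hence `24 = 2 * 3 * 4`. The decay `(n + 1) ^ (-3/2)` makes the series converge on a region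
containing `0`. -/
theorem norm_cpowInterpError_le {x : ℝ} (hx0 : 0 < x) (hx1 : x ≤ 1) (n : ℕ) {s : ℂ}
    (hs : -(1 / 2) < s.re) (hs3 : ‖s‖ < 3) :
    ‖cpowInterpError x n s‖ ≤ 24 * x ^ (-5 : ℝ) * (1 / |(n : ℝ) + 1| ^ (3 / 2 : ℝ)) := by
  have hn : (0 : ℝ) ≤ n := n.cast_nonneg
  -- A lower bound for all three nodes that factors into an `x` part and an `n` part.
  have hδ : 0 < x * (n + 1) := by positivity
  have hδ1 : x * (n + 1) ≤ n + x := by nlinarith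
  have h1 := norm_cpow_neg_sub_linear_le (s := s) (by linarith) hδ
    (show x * (n + 1) ≤ n + 1 by linarith) hδ1
  have h2 := norm_cpow_neg_sub_linear_le (s := s) (by linarith) hδ
    (show x * (n + 1) ≤ n + 1 by linarith) (show x * (n + 1) ≤ n + 2 by linarith)
  have hK : ‖s‖ * (‖s + 1‖ * (x * (n + 1)) ^ (-s.re - 2)) ≤
      3 * (4 * (x ^ (-5 : ℝ) * (1 / |(n : ℝ) + 1| ^ (3 / 2 : ℝ)))) := by
    have hre : s.re < 3 := (Complex.re_le_norm s).trans_lt hs3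
    gcongr
    · exact (norm_add_le _ _).trans (by norm_num; linarith)
    · rw [Real.mul_rpow hx0.le (by positivity)]
      refine mul_le_mul ?_ ?_ (by positivity) (by positivity)
      · exact Real.rpow_le_rpow_of_exponent_ge hx0 hx1 (by linarith)
      · rw [abs_of_pos (by positivity), one_div, ← Real.rpow_neg (by positivity)]
        exact Real.rpow_le_rpow_of_exponent_le (by linarith) (by linarith)
  have ha1 : |((n : ℝ) + x) - (n + 1)| ≤ 1 := by rw [abs_le]; constructor <;> linarith
  have ha2 : |((n : ℝ) + 2) - (n + 1)| ≤ 1 := by rw [abs_le]; constructor <;> linarith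
  have key : ∀ d : ℝ, 0 ≤ d → d ≤ 1 →
      ‖s‖ * (‖s + 1‖ * (x * (n + 1)) ^ (-s.re - 2) * d) * d ≤
      3 * (4 * (x ^ (-5 : ℝ) * (1 / |(n : ℝ) + 1| ^ (3 / 2 : ℝ)))) := by
    intro d hd0 hd1
    refine le_trans ?_ hK
    have : 0 ≤ ‖s‖ * (‖s + 1‖ * (x * (n + 1)) ^ (-s.re - 2)) := by positivity
    calc _ = ‖s‖ * (‖s + 1‖ * (x * (n + 1)) ^ (-s.re - 2)) * (d * d) := by ring
      _ ≤ _ := mul_le_of_le_one_right this (mul_le_one₀ hd1 hd0 hd1)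
  have h1' := h1.trans (key _ (abs_nonneg _) ha1)
  have h2' := h2.trans (key _ (abs_nonneg _) ha2)
  have h3 : ‖(1 - x : ℂ)‖ ≤ 1 := by
    rw [← Complex.ofReal_one, ← Complex.ofReal_sub, Complex.norm_real, Real.norm_eq_abs, abs_le]
    constructor <;> linarith
  have e : cpowInterpError x n s =
      (((n + x : ℝ) : ℂ) ^ (-s) - ((n + 1 : ℝ) : ℂ) ^ (-s) +
        s * ((n + 1 : ℝ) : ℂ) ^ (-s - 1) * (((n + x : ℝ) : ℂ) - ((n + 1 : ℝ) : ℂ))) +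
      (1 - x) * (((n + 2 : ℝ) : ℂ) ^ (-s) - ((n + 1 : ℝ) : ℂ) ^ (-s) +
        s * ((n + 1 : ℝ) : ℂ) ^ (-s - 1) * (((n + 2 : ℝ) : ℂ) - ((n + 1 : ℝ) : ℂ))) := by
    rw [cpowInterpError]; push_cast; ring
  rw [e]
  refine (norm_add_le _ _).trans ?_
  rw [norm_mul]
  have := mul_le_mul h3 h2' (norm_nonneg _) zero_le_one
  linarith

theorem differentiableOn_tsum_cpowInterpError {x : ℝ} (hx0 : 0 < x) (hx1 : x ≤ 1) :
    DifferentiableOn ℂ (fun s ↦ ∑' n, cpowInterpError x n s)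
      ({s | -(1 / 2) < s.re} ∩ Metric.ball 0 3) := by
  refine Complex.differentiableOn_tsum_of_summable_norm
    (((Real.summable_one_div_nat_add_rpow 1 (3 / 2)).2 (by norm_num)).mul_left
      (24 * x ^ (-5 : ℝ))) (fun n ↦ ?_) ?_ fun n s hs ↦ ?_
  · have h : ∀ a : ℝ, 0 < a → Differentiable ℂ fun s : ℂ ↦ (a : ℂ) ^ (-s) := fun a ha ↦
      differentiable_neg.const_cpow (.inl (Complex.ofReal_ne_zero.2 ha.ne'))
    exact (((h _ (by positivity)).sub (h _ (by positivity))).sub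
      (((h _ (by positivity)).sub (h _ (by positivity))).const_mul _)).differentiableOn
  · exact (isOpen_lt continuous_const Complex.continuous_re).inter Metric.isOpen_ball
  · exact norm_cpowInterpError_le hx0 hx1 n hs.1 (by simpa using hs.2)

open HurwitzZeta in
-- The interpolation differences telescope to `1`.
theorem tsum_cpowInterpError {x : ℝ} (hx0 : 0 < x) (hx1 : x ≤ 1) {s : ℂ} (hs : 1 < s.re) :
    ∑' n, cpowInterpError x n s =
      hurwitzZeta (x : UnitAddCircle) s - hurwitzZeta ((1 : ℝ) : UnitAddCircle) s - (1 - x) := by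
  have hA := hasSum_hurwitzZeta_of_one_lt_re (a := x) ⟨hx0.le, hx1⟩ hs
  have hB := hasSum_hurwitzZeta_of_one_lt_re (a := 1) ⟨zero_le_one, le_rfl⟩ hs
  have hC := (hasSum_nat_add_iff' 1).2 hB
  have := ((hA.sub hB).sub ((hB.sub hC).mul_left (1 - x : ℂ))).tsum_eq
  simp only [Finset.range_one, Finset.sum_singleton, Nat.cast_zero, Complex.ofReal_one, zero_add,
    Complex.one_cpow, div_one, sub_sub_cancel, mul_one] at this
  rw [← this]
  refine tsum_congr fun n ↦ ?_
  simp only [cpowInterpError, Complex.cpow_neg, one_div]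
  push_cast
  simp only [add_assoc]
  norm_num

open HurwitzZeta in
/-- The value of the Hurwitz zeta function at `s = 0`. -/
theorem hurwitzZeta_apply_zero {x : ℝ} (hx0 : 0 < x) (hx1 : x ≤ 1) :
    hurwitzZeta (x : UnitAddCircle) 0 = 1 / 2 - x := by
  set U : Set ℂ := {s | -(1 / 2) < s.re} ∩ Metric.ball 0 3
  have hU : IsOpen U :=
    (isOpen_lt continuous_const Complex.continuous_re).inter Metric.isOpen_ball
  have hUc : IsPreconnected U :=
    ((convex_halfSpace_re_gt _).inter (convex_ball 0 3)).isPreconnected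
  have hz : (2 : ℂ) ∈ U := by simp [U]; norm_num
  have h0 : (0 : ℂ) ∈ U := by simp [U]
  have hd : Differentiable ℂ fun s ↦ hurwitzZeta (x : UnitAddCircle) s -
      hurwitzZeta ((1 : ℝ) : UnitAddCircle) s - (1 - x) :=
    (differentiable_hurwitzZeta_sub_hurwitzZeta _ _).sub_const _
  -- The identity is carried from near `2` to `0`, where every term of the series is zero.
  have heq := AnalyticOnNhd.eqOn_of_preconnected_of_eventuallyEq
    ((differentiableOn_tsum_cpowInterpError hx0 hx1).analyticOnNhd hU)
    (hd.differentiableOn.analyticOnNhd hU) hUc hz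
    (by
      filter_upwards [(isOpen_lt continuous_const Complex.continuous_re).mem_nhds
        (show (1 : ℝ) < (2 : ℂ).re by norm_num)] with s hs
      exact tsum_cpowInterpError hx0 hx1 hs) h0
  have h1 : ((1 : ℝ) : UnitAddCircle) = 0 := AddCircle.coe_period 1
  simp only [cpowInterpError, neg_zero, Complex.cpow_zero, sub_self, mul_zero, tsum_zero, h1,
    hurwitzZeta_zero, riemannZeta_zero] at heq
  linear_combination -heq

/-! ### Nonvanishing of `L(χ, 0)` for odd characters. -/

namespace DirichletCharacter

theorem isPrimitive_of_prime {R : Type*} [CommMonoidWithZero R] {p : ℕ} (hp : p.Prime)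
    {χ : DirichletCharacter R p} (hχ : χ ≠ 1) : χ.IsPrimitive := by
  have : NeZero p := ⟨hp.ne_zero⟩
  rcases (Nat.dvd_prime hp).1 χ.conductor_dvd_level with h | h
  · exact absurd (eq_one_iff_conductor_eq_one.2 h) hχ
  · exact h

theorem Odd.ne_one {N : ℕ} {χ : DirichletCharacter ℂ N} (hχ : χ.Odd) : χ ≠ 1 := by
  rintro rfl
  have h : (1 : DirichletCharacter ℂ N) (-1) = -1 := hχ
  rw [MulChar.one_apply isUnit_one.neg] at h
  norm_num at h

/-- The odd gamma factor at `0` is `Γ_ℝ(1) = 1`, so a zero there would pass through the functional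
equation to `L(χ⁻¹, 1)`. -/
theorem LFunction_apply_zero_ne_zero_of_odd {N : ℕ} [NeZero N] {χ : DirichletCharacter ℂ N}
    (hχ : χ.Odd) (hprim : χ⁻¹.IsPrimitive) : LFunction χ 0 ≠ 0 := by
  have hne : χ⁻¹ ≠ 1 := inv_ne_one.2 hχ.ne_one
  have hN : N ≠ 1 := by
    rintro rfl
    exact hχ.ne_one (level_one χ)
  intro h
  rw [LFunction_eq_completed_div_gammaFactor χ 0 (.inr hN), hχ.gammaFactor_def, zero_add,
    Complex.Gammaℝ_one, div_one] at h
  have h1 := hprim.completedLFunction_one_sub 0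
  rw [inv_inv, h, mul_zero, sub_zero] at h1
  refine LFunction_apply_one_ne_zero hne ?_
  rw [LFunction_eq_completed_div_gammaFactor _ 1 (.inr hN), h1, zero_div]

theorem LFunction_apply_zero {N : ℕ} [NeZero N] {χ : DirichletCharacter ℂ N} (hχ : χ ≠ 1) :
    LFunction χ 0 = -(∑ j : ZMod N, χ j * j.val) / N := by
  have hN : N ≠ 1 := by
    rintro rfl
    exact hχ (level_one χ)
  have h : ∀ j : ZMod N, χ j * HurwitzZeta.hurwitzZeta (ZMod.toAddCircle j) 0 =
      χ j * (1 / 2) - χ j * j.val / N := by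
    intro j
    rcases eq_or_ne j 0 with rfl | hj
    · simp [χ.map_zero' hN]
    · rw [ZMod.toAddCircle_apply, hurwitzZeta_apply_zero]
      · push_cast; ring
      · have : 0 < j.val := Nat.pos_of_ne_zero ((ZMod.val_ne_zero j).2 hj)
        have := NeZero.pos N
        positivity
      · rw [div_le_one (by exact_mod_cast NeZero.pos N)]
        exact_mod_cast j.val_lt.le
  rw [LFunction, ZMod.LFunction, neg_zero, Complex.cpow_zero, one_mul]
  simp_rw [h]
  rw [Finset.sum_sub_distrib, ← Finset.sum_mul, χ.sum_eq_zero_of_ne_one hχ, zero_mul, zero_sub,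
    ← Finset.sum_div, neg_div]

/-- The first generalized Bernoulli number of an odd character modulo a prime is nonzero. -/
theorem sum_mul_val_ne_zero_of_odd {p : ℕ} [Fact p.Prime] {χ : DirichletCharacter ℂ p}
    (hχ : χ.Odd) : ∑ j : ZMod p, χ j * (j.val : ℂ) ≠ 0 := by
  intro h
  have h0 := LFunction_apply_zero hχ.ne_one
  rw [h, neg_zero, zero_div] at h0
  exact LFunction_apply_zero_ne_zero_of_odd hχ
    (isPrimitive_of_prime Fact.out (inv_ne_one.2 hχ.ne_one)) h0

end DirichletCharacter

/-! ### The trajectory: recurrence and Fourier sums. -/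

namespace DHKoopman

theorem state_eq_val {p : ℕ} (hp : 1 < p) (m k : ℕ) :
    state p m k = ((m : ZMod p) ^ k).val := by
  have : NeZero p := ⟨by lia⟩
  have : Fact (1 < p) := ⟨hp⟩
  induction k with
  | zero => simp [state, ZMod.val_one]
  | succ k ih =>
    rw [state, step, ih, ← ZMod.val_natCast, Nat.cast_mul, ZMod.natCast_zmod_val, pow_succ']

/-- A primitive root modulo `p` generates the unit group of `ZMod p`. -/
theorem IsPrimitiveRootMod.exists_unit {p m : ℕ} (hm : IsPrimitiveRootMod p m) :
    ∃ g : (ZMod p)ˣ, (g : ZMod p) = m ∧ ∀ x : (ZMod p)ˣ, x ∈ Subgroup.zpowers g := by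
  have key : ∀ c : ℤ, IsCoprime c (p : ℤ) → ∃ k : ℕ, 1 ≤ k ∧ (m : ZMod p) ^ k = c := by
    intro c hc
    obtain ⟨k, hk, h⟩ := hm c hc
    refine ⟨k, hk, ?_⟩
    have := (ZMod.intCast_eq_intCast_iff _ _ _).2 h
    exact_mod_cast this
  obtain ⟨k, hk, h1⟩ := key 1 isCoprime_one_left
  have hu : IsUnit (m : ZMod p) := by
    rw [Int.cast_one] at h1
    exact IsUnit.of_pow_eq_one h1 (by lia)
  refine ⟨hu.unit, hu.unit_spec, fun x ↦ ?_⟩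
  obtain ⟨c, hc⟩ := ZMod.intCast_surjective (x : ZMod p)
  obtain ⟨k, -, h⟩ := key c ((ZMod.coe_int_isUnit_iff_isCoprime c p).1 (hc ▸ x.isUnit)).symm
  refine ⟨k, Units.ext ?_⟩
  simp [h, hc]

section PrimitiveRoot

variable {p m q' : ℕ} [Fact p.Prime]

theorem orderOf_eq_two_mul {g : (ZMod p)ˣ} (hp3 : 3 < p) (hq' : q' = (p - 1) / 2)
    (hg : ∀ x, x ∈ Subgroup.zpowers g) : orderOf g = 2 * q' := by
  rw [orderOf_eq_card_of_forall_mem_zpowers hg, Nat.card_eq_fintype_card, ZMod.card_units]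
  have := (Fact.out : p.Prime).eq_two_or_odd
  lia

theorem primitiveRoot_pow_half (hp3 : 3 < p) (hm : IsPrimitiveRootMod p m)
    (hq' : q' = (p - 1) / 2) : (m : ZMod p) ^ q' = -1 := by
  obtain ⟨g, hgm, hg⟩ := hm.exists_unit
  have ho := orderOf_eq_two_mul hp3 hq' hg
  have h1 : ((m : ZMod p) ^ q') ^ 2 = 1 := by
    rw [← hgm, ← pow_mul, mul_comm, ← ho, ← Units.val_pow_eq_pow_val, pow_orderOf_eq_one,
      Units.val_one]
  refine (sq_eq_one_iff.1 h1).resolve_left fun h ↦ ?_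
  have h2 : g ^ q' = 1 := Units.ext (by rw [Units.val_pow_eq_pow_val, hgm, h, Units.val_one])
  have := Nat.le_of_dvd (by lia) (orderOf_dvd_of_pow_eq_one h2)
  lia

theorem primitiveRoot_ne_zero (hm : IsPrimitiveRootMod p m) : (m : ZMod p) ≠ 0 := by
  obtain ⟨g, hgm, -⟩ := hm.exists_unit
  exact hgm ▸ g.ne_zero

/-- Half a period later, the state is reflected. -/
theorem state_add_half (hp3 : 3 < p) (hm : IsPrimitiveRootMod p m) (hq' : q' = (p - 1) / 2)
    (k : ℕ) : state p m (k + q') + state p m k = p := by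
  have hne : NeZero ((m : ZMod p) ^ k) := ⟨pow_ne_zero k (primitiveRoot_ne_zero hm)⟩
  rw [state_eq_val (by lia), state_eq_val (by lia), pow_add, primitiveRoot_pow_half hp3 hm hq',
    mul_neg_one, ZMod.val_neg_of_ne_zero]
  have := ((m : ZMod p) ^ k).val_lt
  lia

theorem state_recurrence (𝕜 : Type*) [RCLike 𝕜] (hp3 : 3 < p) (hm : IsPrimitiveRootMod p m)
    (hq' : q' = (p - 1) / 2) (k : ℕ) :
    (state p m (k + q' + 1) : 𝕜) =
      state p m (k + q') - state p m (k + 1) + state p m k := by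
  have h0 := state_add_half hp3 hm hq' k
  have h1 := state_add_half hp3 hm hq' (k + 1)
  have h0' : (state p m (k + q') : 𝕜) + state p m k = p := by exact_mod_cast h0
  have h1' : (state p m (k + 1 + q') : 𝕜) + state p m (k + 1) = p := by exact_mod_cast h1
  rw [show k + q' + 1 = k + 1 + q' by ring]
  linear_combination h1' - h0'

theorem state_add_period (hp3 : 3 < p) (hm : IsPrimitiveRootMod p m) (hq' : q' = (p - 1) / 2)
    (k : ℕ) : state p m (k + 2 * q') = state p m k := by
  have h0 := state_add_half hp3 hm hq' k
  have h1 := state_add_half hp3 hm hq' (k + q')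
  rw [show k + 2 * q' = k + q' + q' by ring]
  lia

theorem sum_pow_mul_state_ne_zero_of_pow_eq_neg_one (hp3 : 3 < p) (hm : IsPrimitiveRootMod p m)
    (hq' : q' = (p - 1) / 2) {w : ℂ} (hw : w ^ q' = -1) :
    ∑ k ∈ Finset.range (2 * q'), w ^ k * state p m k ≠ 0 := by
  obtain ⟨g, hgm, hg⟩ := hm.exists_unit
  have ho := orderOf_eq_two_mul hp3 hq' hg
  have hcard : Fintype.card (ZMod p)ˣ = 2 * q' := by
    rw [← ho, orderOf_eq_card_of_forall_mem_zpowers hg, Nat.card_eq_fintype_card]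
  have hw0 : w ≠ 0 := by
    rintro rfl
    rw [zero_pow (by lia)] at hw
    norm_num at hw
  have hζ : Units.mk0 w hw0 ∈ rootsOfUnity (Fintype.card (ZMod p)ˣ) ℂ := by
    rw [mem_rootsOfUnity, hcard]
    ext
    simp [pow_mul', hw]
  -- Oddness: `χ(-1) = χ(m) ^ q' = w ^ q' = -1`.
  let χ : DirichletCharacter ℂ p := MulChar.ofRootOfUnity hζ hg
  have hχm : χ m = w := by
    rw [← hgm]
    exact MulChar.ofRootOfUnity_spec hζ hg
  have hodd : χ.Odd := by
    rw [DirichletCharacter.Odd, ← primitiveRoot_pow_half hp3 hm hq', map_pow, hχm, hw]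
  convert DirichletCharacter.sum_mul_val_ne_zero_of_odd hodd using 1
  refine Finset.sum_of_injOn (fun k ↦ (m : ZMod p) ^ k) ?_ (fun _ _ ↦ by simp) ?_ ?_
  · intro i hi j hj hij
    rw [Finset.coe_range, Set.mem_Iio, ← ho] at hi hj
    refine pow_injOn_Iio_orderOf hi hj (Units.ext ?_)
    simpa [hgm] using hij
  · intro y _ hy
    rcases eq_or_ne y 0 with rfl | hy0
    · simp
    · exfalso
      refine hy ?_
      have := (mem_powers_iff_mem_range_orderOf (x := g) (y := Units.mk0 y hy0)).1
        (mem_powers_iff_mem_zpowers.2 (hg _))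
      obtain ⟨k, hk, hky⟩ := Finset.mem_image.1 this
      refine ⟨k, by rwa [ho] at hk, ?_⟩
      simpa [hgm] using congrArg Units.val hky
  · intro k _
    rw [map_pow, hχm, state_eq_val (by lia)]

theorem sum_pow_shift_mul_state (hp3 : 3 < p) (hm : IsPrimitiveRootMod p m)
    (hq' : q' = (p - 1) / 2) {w : ℂ} (hw : w ^ (2 * q') = 1) (j : ℕ) :
    ∑ k ∈ Finset.range (2 * q'), w ^ (j + k) * state p m (j + k) =
      ∑ k ∈ Finset.range (2 * q'), w ^ k * state p m k := by
  induction j with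
  | zero => simp
  | succ j ih =>
    rw [← ih]
    have h := (Finset.sum_range_succ' (fun k ↦ w ^ (j + k) * (state p m (j + k) : ℂ))
      (2 * q')).symm.trans (Finset.sum_range_succ _ _)
    rw [state_add_period hp3 hm hq', pow_add w j (2 * q'), hw, mul_one, add_zero] at h
    simpa only [add_assoc, add_comm 1] using add_right_cancel h

theorem eq_zero_of_sum_mul_state_eq_zero_complex (hp3 : 3 < p) (hm : IsPrimitiveRootMod p m)
    (hq' : q' = (p - 1) / 2) {c : Fin (q' + 1) → ℂ}
    (hc : ∀ k : ℕ, ∑ j, c j * state p m (j + k) = 0) : c = 0 := by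
  have root : ∀ w : ℂ, w ≠ 0 → w ^ (2 * q') = 1 →
      ∑ k ∈ Finset.range (2 * q'), w ^ k * (state p m k : ℂ) ≠ 0 →
      ∑ j : Fin (q' + 1), w⁻¹ ^ (j : ℕ) * c j = 0 := by
    intro w hw0 hw hS
    refine (mul_eq_zero.1 ?_).resolve_right hS
    calc (∑ j : Fin (q' + 1), w⁻¹ ^ (j : ℕ) * c j) *
          ∑ k ∈ Finset.range (2 * q'), w ^ k * (state p m k : ℂ)
      _ = ∑ j : Fin (q' + 1), w⁻¹ ^ (j : ℕ) * c j *
          ∑ k ∈ Finset.range (2 * q'), w ^ ((j : ℕ) + k) * (state p m (j + k) : ℂ) := by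
        simp_rw [sum_pow_shift_mul_state hp3 hm hq' hw, Finset.sum_mul]
      _ = ∑ k ∈ Finset.range (2 * q'), w ^ k * ∑ j, c j * (state p m (j + k) : ℂ) := by
        simp_rw [Finset.mul_sum]
        rw [Finset.sum_comm]
        refine Finset.sum_congr rfl fun k _ ↦ Finset.sum_congr rfl fun j _ ↦ ?_
        rw [inv_pow, pow_add]
        field_simp
      _ = 0 := by simp [hc]
  have hq0 : 2 * q' ≠ 0 := by lia
  have hω := Complex.isPrimitiveRoot_exp (2 * q') hq0
  set ω : ℂ := Complex.exp (2 * Real.pi * Complex.I / (2 * q' : ℕ))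
  have hωq : ω ^ q' = -1 := by
    have h : (ω ^ q') ^ 2 = 1 := by rw [← pow_mul, mul_comm, hω.pow_eq_one]
    refine (sq_eq_one_iff.1 h).resolve_left fun h1 ↦ ?_
    have := Nat.le_of_dvd (by lia) (hω.dvd_of_pow_eq_one _ h1)
    lia
  -- Odd exponents give the `q'` roots of `z ^ q' = -1`; the last index gives the root `1`.
  let e : Fin (q' + 1) → ℕ := fun i ↦ if (i : ℕ) < q' then 2 * i + 1 else 0
  refine Matrix.eq_zero_of_forall_index_sum_pow_mul_eq_zero (f := fun i ↦ ω ^ e i)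
    (fun i j hij ↦ ?_) fun i ↦ ?_
  · have he : ∀ i, e i < 2 * q' := fun i ↦ by simp only [e]; split_ifs <;> lia
    have := hω.pow_inj (he i) (he j) hij
    have hi := i.isLt
    have hj := j.isLt
    ext
    simp only [e] at this
    split_ifs at this <;> lia
  · have hz0 : ω ^ e i ≠ 0 := pow_ne_zero _ (hω.ne_zero hq0)
    have h := root (ω ^ e i)⁻¹ (inv_ne_zero hz0)
      (by rw [inv_pow, ← pow_mul, mul_comm, pow_mul, hω.pow_eq_one, one_pow, inv_one])
    rw [inv_inv] at h
    refine h ?_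
    by_cases hi : (i : ℕ) < q'
    · refine sum_pow_mul_state_ne_zero_of_pow_eq_neg_one hp3 hm hq' ?_
      simp only [e, hi, if_true]
      rw [inv_pow, ← pow_mul, mul_comm, pow_mul, hωq, Odd.neg_one_pow ⟨_, rfl⟩]
      norm_num
    · simp only [e, hi, if_false, pow_zero, inv_one, one_pow, one_mul]
      rw [← Nat.cast_sum, Nat.cast_ne_zero]
      refine (Finset.sum_pos' (fun _ _ ↦ Nat.zero_le _) ⟨0, by simp; lia, ?_⟩).ne'
      simp [state]

/-- The recurrence extends the first `q' + 1` relations to all shifts; real states let `c` split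
into real and imaginary parts. -/
theorem eq_zero_of_sum_mul_state_eq_zero {𝕜 : Type*} [RCLike 𝕜] (hp3 : 3 < p)
    (hm : IsPrimitiveRootMod p m) (hq' : q' = (p - 1) / 2) {c : Fin (q' + 1) → 𝕜}
    (hc : ∀ k < q' + 1, ∑ j, c j * state p m (j + k) = 0) : c = 0 := by
  have hall : ∀ k, ∑ j, c j * (state p m (j + k) : 𝕜) = 0 := by
    intro k
    induction k using Nat.strong_induction_on with
    | _ k ih =>
      by_cases hk : k < q' + 1
      · exact hc k hk
      · obtain ⟨n, rfl⟩ := Nat.exists_eq_add_of_le' (not_lt.1 hk)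
        have e : ∀ j : Fin (q' + 1), c j * (state p m (j + (n + (q' + 1))) : 𝕜) =
            c j * state p m (j + (n + q')) - c j * state p m (j + (n + 1)) +
              c j * state p m (j + n) := fun j ↦ by
          have := state_recurrence 𝕜 hp3 hm hq' (j + n)
          simp only [← add_assoc] at this ⊢
          rw [this]
          ring
        simp_rw [e]
        rw [Finset.sum_add_distrib, Finset.sum_sub_distrib, ih _ (by lia), ih _ (by lia),
          ih _ (by lia)]
        simp
  have real : ∀ d : Fin (q' + 1) → ℝ, (∀ k, ∑ j, d j * (state p m (j + k) : ℝ) = 0) → d = 0 := by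
    intro d hd
    have := eq_zero_of_sum_mul_state_eq_zero_complex hp3 hm hq' (c := fun j ↦ (d j : ℂ))
      fun k ↦ by exact_mod_cast congrArg Complex.ofReal (hd k)
    ext j
    exact Complex.ofReal_eq_zero.1 (congrFun this j)
  have hre := real (fun j ↦ RCLike.re (c j)) fun k ↦ by
    simpa using congrArg RCLike.re (hall k)
  have him := real (fun j ↦ RCLike.im (c j)) fun k ↦ by
    simpa using congrArg RCLike.im (hall k)
  ext j
  exact RCLike.ext (by simpa using congrFun hre j) (by simpa using congrFun him j)

end PrimitiveRoot

/-! ### Rank of the data matrix and least squares. -/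

section LiftedData

variable {p m q' : ℕ} [Fact p.Prime]

theorem dataZ_apply (𝕜 : Type*) [RCLike 𝕜] (p m q N : ℕ) (j : Fin (q + 1)) (k : Fin N) :
    dataZ 𝕜 p m q N j k = state p m (j + k) := by
  rw [dataZ, Matrix.of_apply, lift_state, add_comm]

theorem eq_zero_of_vecMul_dataZ_eq_zero {𝕜 : Type*} [RCLike 𝕜] {N : ℕ} (hp3 : 3 < p)
    (hm : IsPrimitiveRootMod p m) (hq' : q' = (p - 1) / 2) (hN : q' + 1 ≤ N)
    {c : Fin (q' + 1) → 𝕜} (hc : Matrix.vecMul c (dataZ 𝕜 p m q' N) = 0) : c = 0 := by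
  refine eq_zero_of_sum_mul_state_eq_zero hp3 hm hq' fun k hk ↦ ?_
  simpa [Matrix.vecMul, dotProduct, dataZ_apply] using congrFun hc ⟨k, hk.trans_le hN⟩

theorem rank_dataZ (𝕜 : Type*) [RCLike 𝕜] {N q : ℕ} (hp3 : 3 < p)
    (hm : IsPrimitiveRootMod p m) (hq' : q' = (p - 1) / 2) (hN : q' + 1 ≤ N) (hq : q' ≤ q) :
    (dataZ 𝕜 p m q N).rank = q' + 1 := by
  have hli : LinearIndependent 𝕜 (dataZ 𝕜 p m q' N).row := by
    rw [← Matrix.vecMul_injective_iff]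
    refine (injective_iff_map_eq_zero (Matrix.vecMulLinear (dataZ 𝕜 p m q' N))).2 fun c hc ↦ ?_
    exact eq_zero_of_vecMul_dataZ_eq_zero hp3 hm hq' hN hc
  -- Rows beyond the first `q' + 1` add nothing to the row space, by the recurrence.
  have hmem : ∀ n : ℕ, (fun k : Fin N ↦ (state p m (n + k) : 𝕜)) ∈
      Submodule.span 𝕜 (Set.range (dataZ 𝕜 p m q' N).row) := by
    intro n
    induction n using Nat.strong_induction_on with
    | _ n ih =>
      by_cases hn : n < q' + 1
      · refine Submodule.subset_span ⟨⟨n, hn⟩, ?_⟩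
        ext k
        simp [Matrix.row, dataZ_apply]
      · obtain ⟨r, rfl⟩ := Nat.exists_eq_add_of_le' (not_lt.1 hn)
        convert Submodule.add_mem _ (Submodule.sub_mem _ (ih (r + q') (by lia))
          (ih (r + 1) (by lia))) (ih r (by lia)) using 1
        ext k
        have := state_recurrence 𝕜 hp3 hm hq' (r + k)
        simp only [Pi.add_apply, Pi.sub_apply]
        convert this using 2 <;> ring_nf
  have hspan : Submodule.span 𝕜 (Set.range (dataZ 𝕜 p m q N).row) =
      Submodule.span 𝕜 (Set.range (dataZ 𝕜 p m q' N).row) := by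
    refine le_antisymm (Submodule.span_le.2 ?_) (Submodule.span_mono ?_)
    · rintro _ ⟨j, rfl⟩
      have e : (dataZ 𝕜 p m q N).row j = fun k : Fin N ↦ (state p m (j + k) : 𝕜) := by
        ext k
        simp [Matrix.row, dataZ_apply]
      exact e ▸ hmem j
    · rintro _ ⟨j, rfl⟩
      refine ⟨⟨j, by lia⟩, ?_⟩
      ext k
      simp [Matrix.row, dataZ_apply]
  rw [Matrix.rank_eq_finrank_span_row, hspan, finrank_span_eq_card hli, Fintype.card_fin]

theorem lift_state_succ (𝕜 : Type*) [RCLike 𝕜] (hp3 : 3 < p) (hm : IsPrimitiveRootMod p m)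
    (hq' : q' = (p - 1) / 2) (k : ℕ) :
    lift 𝕜 p m q' (state p m (k + 1)) =
      Matrix.mulVec (companion (coeff 𝕜 q')) (lift 𝕜 p m q' (state p m k)) := by
  -- Keeps the positions `0`, `1`, `q'` of `coeff` distinct.
  have hq2 : 2 ≤ q' := by
    have := (Fact.out : p.Prime).eq_two_or_odd
    lia
  ext i
  rw [lift_state]
  simp only [Matrix.mulVec, dotProduct, companion, Matrix.of_apply, lift_state]
  by_cases hi : i = Fin.last q'
  · have hrec := state_recurrence 𝕜 hp3 hm hq' k
    have e : ∀ j : Fin (q' + 1), coeff 𝕜 q' j * (state p m (k + j) : 𝕜) =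
        (if j = ⟨0, by lia⟩ then (state p m k : 𝕜) else 0) -
        (if j = ⟨1, by lia⟩ then (state p m (k + 1) : 𝕜) else 0) +
        (if j = Fin.last q' then (state p m (k + q') : 𝕜) else 0) := by
      rintro ⟨j, hj⟩
      simp only [coeff, Fin.ext_iff, Fin.val_last]
      by_cases h0 : j = 0
      · subst h0
        simp [show (0 : ℕ) ≠ q' by lia]
      by_cases h1 : j = 1
      · subst h1
        simp [show (1 : ℕ) ≠ q' by lia]
      by_cases h2 : j = q'
      · subst h2
        simp [h0, h1]
      simp [h0, h1, h2]
    simp only [hi, if_true, e, Finset.sum_add_distrib, Finset.sum_sub_distrib,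
      Finset.sum_ite_eq', Finset.mem_univ, Fin.val_last]
    rw [show k + 1 + q' = k + q' + 1 by ring, hrec]
    ring
  · have hlt : (i : ℕ) + 1 < q' + 1 := by
      have := Fin.val_lt_last hi
      lia
    rw [Finset.sum_eq_single ⟨i + 1, hlt⟩]
    · simp [hi, show k + 1 + (i : ℕ) = k + (i + 1) by ring]
    · intro j _ hj
      have : (j : ℕ) ≠ i + 1 := fun h ↦ hj (Fin.ext h)
      simp [hi, this]
    · simp

theorem dataZplus_eq (𝕜 : Type*) [RCLike 𝕜] (N : ℕ) (hp3 : 3 < p) (hm : IsPrimitiveRootMod p m)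
    (hq' : q' = (p - 1) / 2) :
    dataZplus 𝕜 p m q' N = companion (coeff 𝕜 q') * dataZ 𝕜 p m q' N := by
  ext j k
  exact congrFun (lift_state_succ 𝕜 hp3 hm hq' k) j

theorem isUnit_dataZ_mul_transpose (𝕜 : Type*) [RCLike 𝕜] {N : ℕ} (hp3 : 3 < p)
    (hm : IsPrimitiveRootMod p m) (hq' : q' = (p - 1) / 2) (hN : q' + 1 ≤ N) :
    IsUnit (dataZ 𝕜 p m q' N * (dataZ 𝕜 p m q' N).transpose) := by
  -- The entries are real, so `c Z Zᴴ = 0` forces `c Z = 0`.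
  have hT : (dataZ 𝕜 p m q' N).transpose = (dataZ 𝕜 p m q' N).conjTranspose := by
    ext k j
    simp [dataZ_apply]
  open scoped ComplexOrder in
  rw [hT, ← Matrix.vecMul_injective_iff_isUnit]
  refine (injective_iff_map_eq_zero (Matrix.vecMulLinear
    (dataZ 𝕜 p m q' N * (dataZ 𝕜 p m q' N).conjTranspose))).2 fun c hc ↦ ?_
  open scoped ComplexOrder in
  exact eq_zero_of_vecMul_dataZ_eq_zero hp3 hm hq' hN
    ((Matrix.vecMul_self_mul_conjTranspose_eq_zero _ _).1 hc)

attribute [local instance] Matrix.frobeniusNormedAddCommGroup in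
-- `A` attains residual zero, so a minimizer satisfies `B * Z = A * Z`; multiplying by `Zᵀ` allows
-- cancellation.
theorem isEDMDEstimate_mul_iff {𝕜 : Type*} [RCLike 𝕜] {n N : ℕ} {Z : Matrix (Fin n) (Fin N) 𝕜}
    (hZ : IsUnit (Z * Z.transpose)) (A B : Matrix (Fin n) (Fin n) 𝕜) :
    IsEDMDEstimate (A * Z) Z B ↔ B = A := by
  constructor
  · intro h
    have h1 : ‖A * Z - B * Z‖ ≤ ‖A * Z - A * Z‖ := h (Set.mem_univ A)
    rw [sub_self, norm_zero] at h1
    have h2 : B * Z = A * Z := (sub_eq_zero.1 (norm_le_zero_iff.1 h1)).symm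
    refine hZ.mul_right_cancel ?_
    rw [← Matrix.mul_assoc, h2, Matrix.mul_assoc]
  · rintro rfl C -
    simp

end LiftedData

end DHKoopman

theorem mainTheorem5 (𝕜 : Type*) [RCLike 𝕜] (p m N q' : ℕ) (hp : p.Prime) (hp3 : 3 < p)
    (hm : DHKoopman.IsPrimitiveRootMod p m) (hq' : q' = (p - 1) / 2) (hN : q' + 1 ≤ N) :
    -- the rank of the lifted data matrix, for every admissible lifting dimension
    (∀ q : ℕ, q' ≤ q → (DHKoopman.dataZ 𝕜 p m q N).rank = q' + 1) ∧
    -- for the lifting `q = q'`, the companion matrix is an exact linear representation,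
    (∀ k : ℕ, DHKoopman.lift 𝕜 p m q' (DHKoopman.state p m (k + 1)) =
      Matrix.mulVec (DHKoopman.companion (DHKoopman.coeff 𝕜 q'))
        (DHKoopman.lift 𝕜 p m q' (DHKoopman.state p m k))) ∧
    -- it is the one and only solution of the least-squares problem,
    (∀ B : Matrix (Fin (q' + 1)) (Fin (q' + 1)) 𝕜,
      DHKoopman.IsEDMDEstimate (DHKoopman.dataZplus 𝕜 p m q' N) (DHKoopman.dataZ 𝕜 p m q' N) B ↔
        B = DHKoopman.companion (DHKoopman.coeff 𝕜 q')) ∧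
    -- and it is given by the closed formula for the estimate
    IsUnit (DHKoopman.dataZ 𝕜 p m q' N * (DHKoopman.dataZ 𝕜 p m q' N).transpose) ∧
    (DHKoopman.dataZplus 𝕜 p m q' N * (DHKoopman.dataZ 𝕜 p m q' N).transpose) *
        (DHKoopman.dataZ 𝕜 p m q' N * (DHKoopman.dataZ 𝕜 p m q' N).transpose)⁻¹ =
      DHKoopman.companion (DHKoopman.coeff 𝕜 q') := by
  have : Fact p.Prime := ⟨hp⟩
  have hU := DHKoopman.isUnit_dataZ_mul_transpose 𝕜 hp3 hm hq' hN
  refine ⟨fun q hq ↦ DHKoopman.rank_dataZ 𝕜 hp3 hm hq' hN hq,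
    DHKoopman.lift_state_succ 𝕜 hp3 hm hq', fun B ↦ ?_, hU, ?_⟩
  · rw [DHKoopman.dataZplus_eq 𝕜 N hp3 hm hq', DHKoopman.isEDMDEstimate_mul_iff hU]
  · rw [DHKoopman.dataZplus_eq 𝕜 N hp3 hm hq', Matrix.mul_assoc (DHKoopman.companion _),
      Matrix.mul_nonsing_inv_cancel_right _ _ ((Matrix.isUnit_iff_isUnit_det _).1 hU)]
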